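/- Let $n,m\ge 0$ be integers, and let $P_1,\dots,P_m$ be signed $n$-qubit Pauli operators, i.e. each $P_j$ is $\pm\,\sigma_1\otimes\cdots\otimes\sigma_n$ with $\sigma_i\in\{I,X,Y,Z\}$. For such an operator $P$ put $$R(P)=\frac{1+e^{i\pi/4}}{2}\,I+\frac{1-e^{i\pi/4}}{2}\,P .$$ A Clifford+$T$ circuit on $n$ qubits is a finite sequence of gates $H$, $S$, $T=\mathrm{diag}(1,e^{i\pi/4})$ on single qubits and $\mathrm{CNOT}$ on pairs of distinct qubits. A schedule of a circuit assigns a time step to each of its gates so that gates sharing a qubit are performed at different times, in the order of the circuit; its $T$-cycles are the time steps in which at least one $T$ gate is performed. The $T$-depth of the circuit is the minimum number of $T$-cycles over all its schedules. Suppose that 1. $P_iP_j=P_jP_i$ for all $i,j$; 2. there is no non-empty subset $S\subseteq\{1,\dots,m\}$ with $\prod_{j\in S}P_j=\pm I$. Then there is a Clifford+$T$ circuit on the same $n$ qubits that implements exactly the operator $\prod_{j=1}^m R(P_j)$ and in which all $T$ gates can be performed in parallel, i.e. its $T$-depth is at most $1$; if $m\ge 1$, its $T$-depth is exactly $1$.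 -/

import Mathlib

noncomputable section

namespace CliffordT

/-- Operators on `n` qubits: complex matrices indexed by the computational basis `{0,1}^n`. -/
abbrev Operator (n : ℕ) : Type := Matrix (Fin n → Fin 2) (Fin n → Fin 2) ℂ

/-- The tensor product `A 0 ⊗ A 1 ⊗ ⋯ ⊗ A (n-1)` of single-qubit operators. -/
def tensor {n : ℕ} (A : Fin n → Matrix (Fin 2) (Fin 2) ℂ) : Operator n :=
  Matrix.of fun x y => ∏ i, A i (x i) (y i)

/-- The single-qubit operator `A` acting on qubit `i`, the identity on all other qubits. -/
def onQubit {n : ℕ} (A : Matrix (Fin 2) (Fin 2) ℂ) (i : Fin n) : Operator n :=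
  tensor (Function.update (fun _ => 1) i A)

/-! Pauli operators. -/

/-- Labels of the four single-qubit Pauli operators. -/
inductive Pauli : Type
  | I
  | X
  | Y
  | Z

/-- The single-qubit Pauli matrices. -/
def Pauli.matrix : Pauli → Matrix (Fin 2) (Fin 2) ℂ
  | .I => 1
  | .X => !![0, 1; 1, 0]
  | .Y => !![0, -Complex.I; Complex.I, 0]
  | .Z => !![1, 0; 0, -1]

/-- `P` is a Pauli operator on `n` qubits up to a sign: `P = ± σ₁ ⊗ ⋯ ⊗ σₙ`
with every `σᵢ` one of `I`, `X`, `Y`, `Z`. -/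
def IsSignedPauli {n : ℕ} (P : Operator n) : Prop :=
  ∃ σ : Fin n → Pauli,
    P = tensor (fun i => (σ i).matrix) ∨ P = -tensor (fun i => (σ i).matrix)

/-- The phase `e^{iπ/4}`. -/
def omega : ℂ := Complex.exp (Complex.I * (Real.pi / 4))

/-- The `π/4` rotation `R(P) = (1 + e^{iπ/4})/2 · I + (1 - e^{iπ/4})/2 · P`. -/
def R {n : ℕ} (P : Operator n) : Operator n :=
  ((1 + omega) / 2) • (1 : Operator n) + ((1 - omega) / 2) • P

/-! Clifford+T circuits. -/

/-- Gates of the Clifford+T gate set on `n` qubits: Hadamard, phase gate and `T` on any qubit,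
and `CNOT` on any two distinct qubits (first the control, then the target). -/
inductive Gate (n : ℕ) : Type
  | hadamard (i : Fin n)
  | phase (i : Fin n)
  | cnot (i j : Fin n) (hij : i ≠ j)
  | t (i : Fin n)

/-- The unitary matrix of a gate. The matrix of `CNOT` is
`|0⟩⟨0| ⊗ I + |1⟩⟨1| ⊗ X` on (control, target). -/
def Gate.matrix {n : ℕ} : Gate n → Operator n
  | .hadamard i => onQubit ((1 / (Real.sqrt 2 : ℂ)) • !![1, 1; 1, -1]) i
  | .phase i => onQubit !![1, 0; 0, Complex.I] i
  | .cnot i j _ =>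
      onQubit !![1, 0; 0, 0] i + onQubit !![0, 0; 0, 1] i * onQubit Pauli.X.matrix j
  | .t i => onQubit !![1, 0; 0, omega] i

/-- The set of qubits on which a gate acts. -/
def Gate.support {n : ℕ} : Gate n → Finset (Fin n)
  | .hadamard i => {i}
  | .phase i => {i}
  | .cnot i j _ => {i, j}
  | .t i => {i}

/-- The gate is a `T` gate. -/
def Gate.IsT {n : ℕ} : Gate n → Prop
  | .t _ => True
  | _ => False

/-- A Clifford+T circuit on `n` qubits: a list of gates, the first gate being applied first. -/
abbrev Circuit (n : ℕ) : Type := List (Gate n)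

/-- The operator implemented by a circuit; later gates multiply on the left. -/
def Circuit.eval {n : ℕ} : Circuit n → Operator n
  | [] => 1
  | g :: c => Circuit.eval c * g.matrix

/-- A schedule of a circuit assigns a time step to every gate of the circuit, such that gates
which share a qubit are performed one after the other, in the order of the circuit. (Gates
performed at the same time thus act on disjoint sets of qubits.) -/
def Circuit.IsSchedule {n : ℕ} (c : Circuit n) (time : Fin c.length → ℕ) : Prop :=
  ∀ i j : Fin c.length, i < j → ¬ Disjoint (c.get i).support (c.get j).support → time i < time j

/-- The number of `T`-cycles of a schedule: the number of time steps in which at least one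
`T` gate is performed. -/
def Circuit.numTCycles {n : ℕ} (c : Circuit n) (time : Fin c.length → ℕ) : ℕ :=
  (time '' {i | (c.get i).IsT}).ncard

/-- The `T`-depth of a circuit: the minimum number of `T`-cycles over all its schedules. -/
def Circuit.tDepth {n : ℕ} (c : Circuit n) : ℕ :=
  sInf {k | ∃ time : Fin c.length → ℕ, c.IsSchedule time ∧ c.numTCycles time = k}

/-- Every circuit has a schedule, so that the minimum defining the `T`-depth is attained. -/
theorem Circuit.exists_isSchedule {n : ℕ} (c : Circuit n) :
    ∃ time : Fin c.length → ℕ, c.IsSchedule time :=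
  ⟨fun i => i, fun _ _ hij _ => hij⟩

end CliffordT

end

noncomputable section

namespace CliffordT

open Function

variable {n : ℕ}

/-! Algebra of tensor products. -/

/-! A `T` gate on qubit `i` is exactly `R (pauliZ i)`, and `R` is affine in its argument, so it is
compatible with conjugation. If a Clifford `u` conjugates every `P j` to `pauliZ (f j)` with `f`
injective, the product of the `R (P j)` is `u⁻¹ * (product of T gates) * u`. The `T` gates act on
distinct qubits and form one layer, and `u`, `u⁻¹` are implemented exactly, without a stray global
phase, by circuits free of `T`.

The existence of `u` (`exists_clifford_semiconjBy_pauliZ`) is symplectic Gaussian elimination, by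
induction on the set of Paulis treated. The next Pauli becomes `± pauliTensor σ`. Commutation forces
`I` or `Z` on the qubits already used (`eq_I_or_eq_Z_of_commute`). Independence yields a nontrivial
factor on an unused qubit `k`: otherwise the new Pauli would be, up to sign, a product of earlier
ones. Single-qubit Cliffords and CNOTs that fix the earlier `Z` operators then reduce it to `±
pauliZ k` (`exists_clifford_pauliZ`), and an `X` gate on `k` removes the sign. -/

theorem tensor_mul (A B : Fin n → Matrix (Fin 2) (Fin 2) ℂ) :
    tensor A * tensor B = tensor (A * B) := by
  ext x y
  simp only [Matrix.mul_apply, tensor, Matrix.of_apply, Pi.mul_apply, Finset.prod_univ_sum,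
    Fintype.piFinset_univ, Finset.prod_mul_distrib]

theorem tensor_one : tensor (1 : Fin n → Matrix (Fin 2) (Fin 2) ℂ) = 1 := by
  ext x y
  simp only [tensor, Matrix.of_apply, Pi.one_apply, Matrix.one_apply]
  by_cases h : x = y
  · simp [h]
  · obtain ⟨i, hi⟩ := Function.ne_iff.1 h
    rw [if_neg h]
    exact Finset.prod_eq_zero (Finset.mem_univ i) (if_neg hi)

theorem tensor_smul (c : Fin n → ℂ) (A : Fin n → Matrix (Fin 2) (Fin 2) ℂ) :
    tensor (fun i => c i • A i) = (∏ i, c i) • tensor A := by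
  ext x y
  simp [tensor, Finset.prod_mul_distrib]

theorem onQubit_eq_tensor_mulSingle (A : Matrix (Fin 2) (Fin 2) ℂ) (i : Fin n) :
    onQubit A i = tensor (Pi.mulSingle i A) := rfl

theorem onQubit_apply (A : Matrix (Fin 2) (Fin 2) ℂ) (i : Fin n) (x y : Fin n → Fin 2) :
    onQubit A i x y = A (x i) (y i) *
      ∏ j ∈ Finset.univ.erase i, (1 : Matrix (Fin 2) (Fin 2) ℂ) (x j) (y j) := by
  simp only [onQubit, tensor, Matrix.of_apply]
  rw [← Finset.mul_prod_erase _ _ (Finset.mem_univ i)]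
  congr 1
  · simp
  · refine Finset.prod_congr rfl fun j hj => ?_
    rw [update_of_ne (Finset.ne_of_mem_erase hj)]

/-- Single-qubit operators on qubit `i` as a subalgebra of all operators. -/
def onQubitHom (i : Fin n) : Matrix (Fin 2) (Fin 2) ℂ →ₐ[ℂ] Operator n :=
  AlgHom.ofLinearMap
    { toFun := fun A => onQubit A i
      map_add' := fun A B => by
        ext x y
        simp [onQubit_apply, add_mul]
      map_smul' := fun c A => by
        ext x y
        simp [onQubit_apply, mul_assoc] }
    (by
      change onQubit 1 i = 1
      rw [onQubit_eq_tensor_mulSingle, Pi.mulSingle_one, tensor_one])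
    (fun A B => by
      change onQubit (A * B) i = onQubit A i * onQubit B i
      rw [onQubit_eq_tensor_mulSingle, onQubit_eq_tensor_mulSingle, onQubit_eq_tensor_mulSingle,
        tensor_mul, Pi.mulSingle_mul])

theorem onQubit_eq (A : Matrix (Fin 2) (Fin 2) ℂ) (i : Fin n) :
    onQubit A i = onQubitHom i A := rfl

theorem onQubitHom_mul_tensor (A : Matrix (Fin 2) (Fin 2) ℂ) (i : Fin n)
    (B : Fin n → Matrix (Fin 2) (Fin 2) ℂ) :
    onQubitHom i A * tensor B = tensor (update B i (A * B i)) := by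
  rw [← onQubit_eq, onQubit_eq_tensor_mulSingle, tensor_mul]
  congr 1
  ext1 j
  by_cases h : j = i
  · subst h; simp
  · simp [h]

theorem tensor_mul_onQubitHom (A : Matrix (Fin 2) (Fin 2) ℂ) (i : Fin n)
    (B : Fin n → Matrix (Fin 2) (Fin 2) ℂ) :
    tensor B * onQubitHom i A = tensor (update B i (B i * A)) := by
  rw [← onQubit_eq, onQubit_eq_tensor_mulSingle, tensor_mul]
  congr 1
  ext1 j
  by_cases h : j = i
  · subst h; simp
  · simp [h]

theorem tensor_eq_onQubitHom_mul (i : Fin n) (B : Fin n → Matrix (Fin 2) (Fin 2) ℂ) :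
    tensor B = onQubitHom i (B i) * tensor (update B i 1) := by
  simp [onQubitHom_mul_tensor]

theorem commute_onQubitHom_tensor (A : Matrix (Fin 2) (Fin 2) ℂ) (i : Fin n)
    {B : Fin n → Matrix (Fin 2) (Fin 2) ℂ} (h : B i = 1) :
    Commute (onQubitHom i A) (tensor B) := by
  rw [commute_iff_eq, onQubitHom_mul_tensor, tensor_mul_onQubitHom, h, one_mul, mul_one]

theorem commute_onQubitHom {i j : Fin n} (h : i ≠ j) (A B : Matrix (Fin 2) (Fin 2) ℂ) :
    Commute (onQubitHom i A) (onQubitHom j B) := by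
  rw [← onQubit_eq B, onQubit_eq_tensor_mulSingle]
  exact commute_onQubitHom_tensor A i
    (Pi.mulSingle_eq_of_ne (M := fun _ => Matrix (Fin 2) (Fin 2) ℂ) h B)

/-! Scalar multiples of Pauli operators. -/

/-- The phase can stay unspecified: for conjugates of signed Paulis,
`IsSignedPauli.exists_semiconjBy` later recovers it up to sign by squaring. -/
theorem Pauli.exists_mul (a b : Pauli) :
    ∃ (c : ℂ) (d : Pauli), a.matrix * b.matrix = c • d.matrix := by
  have key : ∀ (c : ℂ) (d : Pauli), a.matrix * b.matrix = c • d.matrix →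
      ∃ (c : ℂ) (d : Pauli), a.matrix * b.matrix = c • d.matrix := fun c d h => ⟨c, d, h⟩
  cases a <;> cases b
  · exact key 1 .I (by simp [Pauli.matrix])
  · exact key 1 .X (by simp [Pauli.matrix])
  · exact key 1 .Y (by simp [Pauli.matrix])
  · exact key 1 .Z (by simp [Pauli.matrix])
  · exact key 1 .X (by simp [Pauli.matrix])
  · exact key 1 .I (by simp [Pauli.matrix, Matrix.one_fin_two])
  · exact key Complex.I .Z (by simp [Pauli.matrix])
  · exact key (-Complex.I) .Y (by simp [Pauli.matrix])
  · exact key 1 .Y (by simp [Pauli.matrix])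
  · exact key (-Complex.I) .Z (by simp [Pauli.matrix])
  · exact key 1 .I (by simp [Pauli.matrix, Matrix.one_fin_two])
  · exact key Complex.I .X (by simp [Pauli.matrix])
  · exact key 1 .Z (by simp [Pauli.matrix])
  · exact key Complex.I .Y (by simp [Pauli.matrix])
  · exact key (-Complex.I) .X (by simp [Pauli.matrix])
  · exact key 1 .I (by simp [Pauli.matrix, Matrix.one_fin_two])

theorem Pauli.matrix_mul_self (a : Pauli) : a.matrix * a.matrix = 1 := by
  cases a <;> simp [Pauli.matrix, Matrix.one_fin_two]

/-- The tensor product of Pauli matrices with labels `σ`. -/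
def pauliTensor (σ : Fin n → Pauli) : Operator n := tensor fun i => (σ i).matrix

theorem pauliTensor_mul_self (σ : Fin n → Pauli) : pauliTensor σ * pauliTensor σ = 1 := by
  rw [pauliTensor, tensor_mul, ← tensor_one]
  congr 1
  ext1 i
  exact (σ i).matrix_mul_self

theorem pauliTensor_update (σ : Fin n → Pauli) (i : Fin n) (a : Pauli) :
    pauliTensor (update σ i a) = tensor (update (fun i => (σ i).matrix) i a.matrix) := by
  unfold pauliTensor
  congr 1
  ext1 j
  by_cases h : j = i
  · subst h; simp
  · simp [h]

theorem pauliTensor_eq_onQubitHom_mul (i : Fin n) (σ : Fin n → Pauli) :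
    pauliTensor σ = onQubitHom i (σ i).matrix * pauliTensor (update σ i .I) := by
  rw [pauliTensor_update]
  exact tensor_eq_onQubitHom_mul i _

/-- Scalar multiples of Pauli operators form a monoid. -/
def scaledPaulis (n : ℕ) : Submonoid (Operator n) where
  carrier := {P | ∃ (c : ℂ) (σ : Fin n → Pauli), P = c • pauliTensor σ}
  one_mem' := ⟨1, fun _ => .I, by
    rw [one_smul, ← tensor_one]
    rfl⟩
  mul_mem' := by
    rintro _ _ ⟨c, σ, rfl⟩ ⟨d, τ, rfl⟩
    choose e ρ h using fun i => Pauli.exists_mul (σ i) (τ i)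
    refine ⟨c * d * ∏ i, e i, ρ, ?_⟩
    rw [smul_mul_smul_comm, mul_smul (c * d)]
    congr 1
    rw [pauliTensor, pauliTensor, pauliTensor, tensor_mul, ← tensor_smul]
    congr 1
    ext1 i
    exact h i

theorem smul_mem_scaledPaulis {P : Operator n} (c : ℂ) (h : P ∈ scaledPaulis n) :
    c • P ∈ scaledPaulis n := by
  obtain ⟨d, σ, rfl⟩ := h
  exact ⟨c * d, σ, smul_smul _ _ _⟩

theorem IsSignedPauli.mem_scaledPaulis {P : Operator n} (h : IsSignedPauli P) :
    P ∈ scaledPaulis n := by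
  obtain ⟨σ, rfl | rfl⟩ := h
  · exact ⟨1, σ, (one_smul _ _).symm⟩
  · exact ⟨-1, σ, (neg_one_smul _ _).symm⟩

theorem IsSignedPauli.mul_self {P : Operator n} (h : IsSignedPauli P) : P * P = 1 := by
  obtain ⟨σ, rfl | rfl⟩ := h
  · exact pauliTensor_mul_self σ
  · rw [neg_mul_neg]
    exact pauliTensor_mul_self σ

theorem onQubitHom_mem_scaledPaulis (i : Fin n) (a : Pauli) :
    onQubitHom i a.matrix ∈ scaledPaulis n := by
  refine ⟨1, update (fun _ => .I) i a, ?_⟩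
  rw [pauliTensor_update, one_smul]
  rfl

theorem Pauli.matrix_Y : Pauli.Y.matrix = Complex.I • (Pauli.X.matrix * Pauli.Z.matrix) := by
  simp [Pauli.matrix]

/-- Since `Y = iXZ`, the single-qubit `X` and `Z` generate all Paulis up to scalars. Gates therefore
need to be checked on these generators only. -/
theorem scaledPaulis_induction {p : Operator n → Prop} (one : p 1)
    (smul : ∀ (c : ℂ) P, p P → p (c • P)) (mul : ∀ P Q, p P → p Q → p (P * Q))
    (X : ∀ i, p (onQubitHom i Pauli.X.matrix)) (Z : ∀ i, p (onQubitHom i Pauli.Z.matrix))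
    {P : Operator n} (hP : P ∈ scaledPaulis n) : p P := by
  obtain ⟨c, σ, rfl⟩ := hP
  refine smul c _ ?_
  have single : ∀ i (a : Pauli), p (onQubitHom i a.matrix) := by
    rintro i (_ | _ | _ | _)
    · change p (onQubitHom i 1)
      rw [map_one]
      exact one
    · exact X i
    · rw [Pauli.matrix_Y, map_smul, map_mul]
      exact smul _ _ (mul _ _ (X i) (Z i))
    · exact Z i
  suffices h : ∀ (s : Finset (Fin n)) (σ : Fin n → Pauli), (∀ i ∉ s, σ i = .I) →
      p (pauliTensor σ) from h Finset.univ σ (by simp)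
  intro s
  induction s using Finset.induction_on with
  | empty =>
    intro σ h
    have : σ = fun _ => .I := funext fun i => h i (Finset.notMem_empty i)
    subst this
    have h1 : pauliTensor (fun _ : Fin n => Pauli.I) = 1 := tensor_one
    rwa [h1]
  | insert a s _ ih =>
    intro σ h
    rw [pauliTensor_eq_onQubitHom_mul a]
    refine mul _ _ (single _ _) (ih _ fun i hi => ?_)
    by_cases hia : i = a
    · subst hia; simp
    · rw [update_of_ne hia]
      exact h i (by simp [hia, hi])

/-! Clifford circuits. -/

theorem Circuit.eval_append (c d : Circuit n) :
    Circuit.eval (c ++ d) = Circuit.eval d * Circuit.eval c := by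
  induction c with
  | nil => simp [Circuit.eval]
  | cons g c ih => simp [Circuit.eval, ih, mul_assoc]

theorem Circuit.eval_reverse (c : Circuit n) :
    Circuit.eval c.reverse = (c.map Gate.matrix).prod := by
  induction c with
  | nil => simp [Circuit.eval]
  | cons g c ih => simp [Circuit.eval, Circuit.eval_append, ih]

/-- Operators implemented by circuits without `T` gates. -/
def cliffordOperators (n : ℕ) : Submonoid (Operator n) where
  carrier := {U | ∃ c : Circuit n, (∀ g ∈ c, ¬ g.IsT) ∧ Circuit.eval c = U}
  one_mem' := ⟨[], by simp, rfl⟩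
  mul_mem' := by
    rintro _ _ ⟨c, hc, rfl⟩ ⟨d, hd, rfl⟩
    refine ⟨d ++ c, fun g hg => ?_, Circuit.eval_append d c⟩
    exact (List.mem_append.1 hg).elim (hd g) (hc g)

theorem Gate.matrix_mem_cliffordOperators {g : Gate n} (h : ¬ g.IsT) :
    g.matrix ∈ cliffordOperators n :=
  ⟨[g], by simpa using h, by simp [Circuit.eval]⟩

/-- Invertible operators implemented by circuits without `T` gates, which conjugate Pauli
operators to scalar multiples of Pauli operators. -/
def cliffordMonoid (n : ℕ) : Submonoid (Operator n)ˣ where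
  carrier := {u | (u : Operator n) ∈ cliffordOperators n ∧
    ∀ P ∈ scaledPaulis n, u * P * ↑u⁻¹ ∈ scaledPaulis n}
  one_mem' := ⟨one_mem _, by simp⟩
  mul_mem' := by
    rintro u v ⟨hu, hu'⟩ ⟨hv, hv'⟩
    refine ⟨mul_mem hu hv, fun P hP => ?_⟩
    have := hu' _ (hv' P hP)
    simpa [mul_assoc] using this

/-- The Clifford group. -/
def cliffordGroup (n : ℕ) : Subgroup (Operator n)ˣ where
  carrier := {u | u ∈ cliffordMonoid n ∧ u⁻¹ ∈ cliffordMonoid n}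
  one_mem' := ⟨one_mem _, by simp⟩
  mul_mem' := by
    rintro u v ⟨hu, hu'⟩ ⟨hv, hv'⟩
    exact ⟨mul_mem hu hv, by simpa using mul_mem hv' hu'⟩
  inv_mem' := by
    rintro u ⟨hu, hu'⟩
    exact ⟨hu', by simpa using hu⟩

theorem conj_mem_scaledPaulis {u : (Operator n)ˣ}
    (hX : ∀ i, ∃ Q ∈ scaledPaulis n, SemiconjBy ↑u (onQubitHom i Pauli.X.matrix) Q)
    (hZ : ∀ i, ∃ Q ∈ scaledPaulis n, SemiconjBy ↑u (onQubitHom i Pauli.Z.matrix) Q)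
    {P : Operator n} (hP : P ∈ scaledPaulis n) : u * P * ↑u⁻¹ ∈ scaledPaulis n := by
  have key : ∃ Q ∈ scaledPaulis n, SemiconjBy ↑u P Q := by
    refine scaledPaulis_induction (p := fun P => ∃ Q ∈ scaledPaulis n, SemiconjBy ↑u P Q)
      ⟨1, one_mem _, SemiconjBy.one_right _⟩ ?_ ?_ hX hZ hP
    · rintro c P ⟨Q, hQ, h⟩
      refine ⟨c • Q, smul_mem_scaledPaulis c hQ, ?_⟩
      rw [SemiconjBy, mul_smul_comm, h.eq, smul_mul_assoc]
    · rintro P P' ⟨Q, hQ, h⟩ ⟨Q', hQ', h'⟩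
      exact ⟨Q * Q', mul_mem hQ hQ', h.mul_right h'⟩
  obtain ⟨Q, hQ, h⟩ := key
  rwa [h.eq, Units.mul_inv_cancel_right]

/-- The inverse is the cube, so it inherits both the circuit and the action on Paulis. The exponent
4 serves all gates: `H` and CNOT are involutions, and the phase gate has order 4. -/
theorem mem_cliffordGroup_of_pow_four {u : (Operator n)ˣ} (h : u ^ 4 = 1)
    (hu : (u : Operator n) ∈ cliffordOperators n)
    (hX : ∀ i, ∃ Q ∈ scaledPaulis n, SemiconjBy ↑u (onQubitHom i Pauli.X.matrix) Q)
    (hZ : ∀ i, ∃ Q ∈ scaledPaulis n, SemiconjBy ↑u (onQubitHom i Pauli.Z.matrix) Q) :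
    u ∈ cliffordGroup n := by
  have hmem : u ∈ cliffordMonoid n := ⟨hu, fun P hP => conj_mem_scaledPaulis hX hZ hP⟩
  have hinv : u⁻¹ = u ^ 3 := inv_eq_of_mul_eq_one_left (by rw [← pow_succ, h])
  exact ⟨hmem, hinv ▸ pow_mem hmem 3⟩

/-! The Hadamard gate. -/

theorem sqrt_two_inv_mul_self : ((Real.sqrt 2 : ℂ))⁻¹ * ((Real.sqrt 2 : ℂ))⁻¹ = 2⁻¹ := by
  rw [← mul_inv, ← Complex.ofReal_mul, Real.mul_self_sqrt (by norm_num)]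
  norm_num

theorem hadamard_mul_self :
    ((1 / (Real.sqrt 2 : ℂ)) • !![1, 1; 1, -1] : Matrix (Fin 2) (Fin 2) ℂ) *
      ((1 / (Real.sqrt 2 : ℂ)) • !![1, 1; 1, -1]) = 1 := by
  rw [smul_mul_smul_comm, one_div, sqrt_two_inv_mul_self, Matrix.one_fin_two]
  simp
  norm_num

/-- The Hadamard gate on qubit `i`. -/
def hadamardUnit (i : Fin n) : (Operator n)ˣ where
  val := (Gate.hadamard i).matrix
  inv := (Gate.hadamard i).matrix
  val_inv := by
    simp only [Gate.matrix, onQubit_eq]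
    rw [← map_mul, hadamard_mul_self, map_one]
  inv_val := by
    simp only [Gate.matrix, onQubit_eq]
    rw [← map_mul, hadamard_mul_self, map_one]

theorem hadamardUnit_semiconjBy_X (i : Fin n) :
    SemiconjBy ↑(hadamardUnit i) (onQubitHom i Pauli.X.matrix)
      (onQubitHom i Pauli.Z.matrix) := by
  simp only [hadamardUnit, Gate.matrix, onQubit_eq, SemiconjBy, ← map_mul]
  simp [Pauli.matrix]

theorem hadamardUnit_semiconjBy_Z (i : Fin n) :
    SemiconjBy ↑(hadamardUnit i) (onQubitHom i Pauli.Z.matrix)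
      (onQubitHom i Pauli.X.matrix) := by
  simp only [hadamardUnit, Gate.matrix, onQubit_eq, SemiconjBy, ← map_mul]
  simp [Pauli.matrix]

theorem hadamardUnit_commute {i j : Fin n} (h : i ≠ j) (A : Matrix (Fin 2) (Fin 2) ℂ) :
    Commute ↑(hadamardUnit i) (onQubitHom j A) :=
  commute_onQubitHom h _ A

theorem hadamardUnit_commute_tensor {i : Fin n} {B : Fin n → Matrix (Fin 2) (Fin 2) ℂ}
    (h : B i = 1) : Commute ↑(hadamardUnit i) (tensor B) :=
  commute_onQubitHom_tensor _ i h

theorem hadamardUnit_mem (i : Fin n) : hadamardUnit i ∈ cliffordGroup n := by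
  refine mem_cliffordGroup_of_pow_four ?_ ?_ ?_ ?_
  · have h : hadamardUnit i * hadamardUnit i = 1 := Units.ext (hadamardUnit i).val_inv
    rw [show 4 = 2 * 2 from rfl, pow_mul, sq (hadamardUnit i), h, one_pow]
  · exact Gate.matrix_mem_cliffordOperators (g := .hadamard i) id
  · intro j
    by_cases h : i = j
    · subst h
      exact ⟨_, onQubitHom_mem_scaledPaulis i _, hadamardUnit_semiconjBy_X i⟩
    · exact ⟨_, onQubitHom_mem_scaledPaulis j _, hadamardUnit_commute h _⟩
  · intro j
    by_cases h : i = j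
    · subst h
      exact ⟨_, onQubitHom_mem_scaledPaulis i _, hadamardUnit_semiconjBy_Z i⟩
    · exact ⟨_, onQubitHom_mem_scaledPaulis j _, hadamardUnit_commute h _⟩

/-! The phase gate. -/

/-- The phase gate on qubit `i`. -/
def phaseUnit (i : Fin n) : (Operator n)ˣ where
  val := (Gate.phase i).matrix
  inv := onQubit !![1, 0; 0, -Complex.I] i
  val_inv := by
    simp only [Gate.matrix, onQubit_eq]
    rw [← map_mul, ← map_one (onQubitHom i)]
    simp [Matrix.one_fin_two]
  inv_val := by
    simp only [Gate.matrix, onQubit_eq]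
    rw [← map_mul, ← map_one (onQubitHom i)]
    simp [Matrix.one_fin_two]

theorem phaseUnit_semiconjBy_X (i : Fin n) :
    SemiconjBy ↑(phaseUnit i) (onQubitHom i Pauli.X.matrix)
      (onQubitHom i Pauli.Y.matrix) := by
  simp only [phaseUnit, Gate.matrix, onQubit_eq, SemiconjBy, ← map_mul]
  simp [Pauli.matrix]

theorem phaseUnit_semiconjBy_Z (i : Fin n) :
    SemiconjBy ↑(phaseUnit i) (onQubitHom i Pauli.Z.matrix)
      (onQubitHom i Pauli.Z.matrix) := by
  simp only [phaseUnit, Gate.matrix, onQubit_eq, SemiconjBy, ← map_mul]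
  simp [Pauli.matrix]

theorem phaseUnit_mul_self (i : Fin n) :
    (phaseUnit i * phaseUnit i : (Operator n)ˣ) = onQubitHom i Pauli.Z.matrix := by
  simp only [phaseUnit, Gate.matrix, onQubit_eq, Units.val_mul, ← map_mul]
  simp [Pauli.matrix]

theorem phaseUnit_commute {i j : Fin n} (h : i ≠ j) (A : Matrix (Fin 2) (Fin 2) ℂ) :
    Commute ↑(phaseUnit i) (onQubitHom j A) :=
  commute_onQubitHom h _ A

theorem phaseUnit_commute_tensor {i : Fin n} {B : Fin n → Matrix (Fin 2) (Fin 2) ℂ}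
    (h : B i = 1) : Commute ↑(phaseUnit i) (tensor B) :=
  commute_onQubitHom_tensor _ i h

theorem phaseUnit_mem (i : Fin n) : phaseUnit i ∈ cliffordGroup n := by
  refine mem_cliffordGroup_of_pow_four ?_ ?_ ?_ ?_
  · apply Units.ext
    rw [show 4 = 2 * 2 from rfl, pow_mul, sq (phaseUnit i), sq, Units.val_mul,
      phaseUnit_mul_self, ← map_mul, Pauli.matrix_mul_self, map_one, Units.val_one]
  · exact Gate.matrix_mem_cliffordOperators (g := .phase i) id
  · intro j
    by_cases h : i = j
    · subst h
      exact ⟨_, onQubitHom_mem_scaledPaulis i _, phaseUnit_semiconjBy_X i⟩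
    · exact ⟨_, onQubitHom_mem_scaledPaulis j _, phaseUnit_commute h _⟩
  · intro j
    by_cases h : i = j
    · subst h
      exact ⟨_, onQubitHom_mem_scaledPaulis i _, phaseUnit_semiconjBy_Z i⟩
    · exact ⟨_, onQubitHom_mem_scaledPaulis j _, phaseUnit_commute h _⟩

/-! The controlled-not gate. -/

theorem cnot_matrix_eq {i j : Fin n} (hij : i ≠ j) :
    (Gate.cnot i j hij).matrix = onQubitHom i !![1, 0; 0, 0] +
      onQubitHom i !![0, 0; 0, 1] * onQubitHom j Pauli.X.matrix := rfl

/-- The two projections on the control are orthogonal, sum to 1 and commute with `X` on the target.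
Cross terms vanish and `X² = 1`. -/
theorem cnot_mul_self {i j : Fin n} (hij : i ≠ j) :
    (Gate.cnot i j hij).matrix * (Gate.cnot i j hij).matrix = 1 := by
  have hc := commute_onQubitHom hij.symm Pauli.X.matrix !![0, 0; 0, 1]
  have hc' := commute_onQubitHom hij.symm Pauli.X.matrix !![1, 0; 0, 0]
  have h00 : onQubitHom i !![1, 0; 0, 0] * onQubitHom i !![1, 0; 0, 0] =
      onQubitHom i !![1, 0; 0, 0] := by
    rw [← map_mul]
    congr 1; ext a b; fin_cases a <;> fin_cases b <;> simp
  have h11 : onQubitHom i !![0, 0; 0, 1] * onQubitHom i !![0, 0; 0, 1] =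
      onQubitHom i !![0, 0; 0, 1] := by
    rw [← map_mul]
    congr 1; ext a b; fin_cases a <;> fin_cases b <;> simp
  have h01 : onQubitHom i !![1, 0; 0, 0] * onQubitHom i !![0, 0; 0, 1] = 0 := by
    rw [← map_mul, ← map_zero (onQubitHom i)]
    congr 1; ext a b; fin_cases a <;> fin_cases b <;> simp
  have h10 : onQubitHom i !![0, 0; 0, 1] * onQubitHom i !![1, 0; 0, 0] = 0 := by
    rw [← map_mul, ← map_zero (onQubitHom i)]
    congr 1; ext a b; fin_cases a <;> fin_cases b <;> simp
  have hX : onQubitHom j Pauli.X.matrix * onQubitHom j Pauli.X.matrix = 1 := by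
    rw [← map_mul, Pauli.matrix_mul_self, map_one]
  have hsum : onQubitHom i !![1, 0; 0, 0] + onQubitHom i !![0, 0; 0, 1] = 1 := by
    rw [← map_add, ← map_one (onQubitHom i)]; congr 1; simp [Matrix.one_fin_two]
  rw [cnot_matrix_eq, add_mul, mul_add, mul_add, h00, ← mul_assoc, h01, zero_mul, add_zero,
    mul_assoc, hc'.eq, ← mul_assoc, h10, zero_mul, zero_add, mul_assoc,
    ← mul_assoc _ _ (onQubitHom j _),
    hc.eq, mul_assoc, hX, mul_one, h11, hsum]

/-- The controlled-not gate with control `i` and target `j`. -/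
def cnotUnit {i j : Fin n} (hij : i ≠ j) : (Operator n)ˣ where
  val := (Gate.cnot i j hij).matrix
  inv := (Gate.cnot i j hij).matrix
  val_inv := cnot_mul_self hij
  inv_val := cnot_mul_self hij

theorem cnotUnit_val {i j : Fin n} (hij : i ≠ j) :
    (cnotUnit hij : Operator n) = onQubitHom i !![1, 0; 0, 0] +
      onQubitHom i !![0, 0; 0, 1] * onQubitHom j Pauli.X.matrix := rfl

theorem cnotUnit_commute_tensor {i j : Fin n} (hij : i ≠ j)
    {B : Fin n → Matrix (Fin 2) (Fin 2) ℂ} (hi : B i = 1) (hj : B j = 1) :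
    Commute ↑(cnotUnit hij) (tensor B) := by
  rw [cnotUnit_val]
  exact (commute_onQubitHom_tensor _ i hi).add_left
    ((commute_onQubitHom_tensor _ i hi).mul_left (commute_onQubitHom_tensor _ j hj))

theorem cnotUnit_commute {i j k : Fin n} (hij : i ≠ j) (hi : i ≠ k) (hj : j ≠ k)
    (A : Matrix (Fin 2) (Fin 2) ℂ) : Commute ↑(cnotUnit hij) (onQubitHom k A) := by
  rw [cnotUnit_val]
  exact (commute_onQubitHom hi _ A).add_left
    ((commute_onQubitHom hi _ A).mul_left (commute_onQubitHom hj _ A))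

theorem cnotUnit_commute_control {i j : Fin n} (hij : i ≠ j) :
    Commute ↑(cnotUnit hij) (onQubitHom i Pauli.Z.matrix) := by
  have h0 : Commute (onQubitHom i !![1, 0; 0, 0]) (onQubitHom i Pauli.Z.matrix) := by
    rw [commute_iff_eq, ← map_mul, ← map_mul]
    congr 1; ext a b; fin_cases a <;> fin_cases b <;> simp [Pauli.matrix]
  have h1 : Commute (onQubitHom i !![0, 0; 0, 1]) (onQubitHom i Pauli.Z.matrix) := by
    rw [commute_iff_eq, ← map_mul, ← map_mul]
    congr 1; ext a b; fin_cases a <;> fin_cases b <;> simp [Pauli.matrix]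
  rw [cnotUnit_val]
  exact h0.add_left (h1.mul_left (commute_onQubitHom hij.symm _ _))

theorem cnotUnit_commute_target {i j : Fin n} (hij : i ≠ j) :
    Commute ↑(cnotUnit hij) (onQubitHom j Pauli.X.matrix) := by
  rw [cnotUnit_val]
  exact (commute_onQubitHom hij _ _).add_left
    ((commute_onQubitHom hij _ _).mul_left (Commute.refl _))

/-- On the branch where the target is flipped, `XZ = -ZX` produces a sign, which is the eigenvalue
of `Z` on the control. -/
theorem cnotUnit_semiconjBy_Z {i j : Fin n} (hij : i ≠ j) :
    SemiconjBy ↑(cnotUnit hij) (onQubitHom j Pauli.Z.matrix)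
      (onQubitHom i Pauli.Z.matrix * onQubitHom j Pauli.Z.matrix) := by
  have h0 : onQubitHom i Pauli.Z.matrix * onQubitHom i !![1, 0; 0, 0] =
      onQubitHom i !![1, 0; 0, 0] := by
    rw [← map_mul]; simp [Pauli.matrix]
  have h1 : onQubitHom i Pauli.Z.matrix * onQubitHom i !![0, 0; 0, 1] =
      -onQubitHom i !![0, 0; 0, 1] := by
    rw [← map_mul, ← map_neg]; simp [Pauli.matrix]
  have hXZ : onQubitHom j Pauli.X.matrix * onQubitHom j Pauli.Z.matrix =
      -(onQubitHom j Pauli.Z.matrix * onQubitHom j Pauli.X.matrix) := by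
    rw [← map_mul, ← map_mul, ← map_neg]; simp [Pauli.matrix]
  rw [SemiconjBy, cnotUnit_val, add_mul, mul_add, mul_assoc, hXZ, mul_assoc, mul_assoc,
    ← (commute_onQubitHom hij _ Pauli.Z.matrix).eq, ← mul_assoc, h0,
    ← mul_assoc (onQubitHom j _), ← (commute_onQubitHom hij _ Pauli.Z.matrix).eq, ← mul_assoc,
    ← mul_assoc, h1, mul_neg, neg_mul, neg_mul, mul_assoc]

/-- `X` on the control exchanges the two projections, so exactly one side of the exchange carries an
`X` on the target. -/
theorem cnotUnit_semiconjBy_X {i j : Fin n} (hij : i ≠ j) :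
    SemiconjBy ↑(cnotUnit hij) (onQubitHom i Pauli.X.matrix)
      (onQubitHom i Pauli.X.matrix * onQubitHom j Pauli.X.matrix) := by
  have h0 : onQubitHom i !![1, 0; 0, 0] * onQubitHom i Pauli.X.matrix =
      onQubitHom i Pauli.X.matrix * onQubitHom i !![0, 0; 0, 1] := by
    rw [← map_mul, ← map_mul]
    congr 1; ext a b; fin_cases a <;> fin_cases b <;> simp [Pauli.matrix]
  have h1 : onQubitHom i !![0, 0; 0, 1] * onQubitHom i Pauli.X.matrix =
      onQubitHom i Pauli.X.matrix * onQubitHom i !![1, 0; 0, 0] := by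
    rw [← map_mul, ← map_mul]
    congr 1; ext a b; fin_cases a <;> fin_cases b <;> simp [Pauli.matrix]
  have hX : onQubitHom j Pauli.X.matrix * onQubitHom j Pauli.X.matrix = 1 := by
    rw [← map_mul, Pauli.matrix_mul_self, map_one]
  have hx := (commute_onQubitHom hij.symm Pauli.X.matrix Pauli.X.matrix).eq
  have he0 := (commute_onQubitHom hij.symm Pauli.X.matrix !![1, 0; 0, 0]).eq
  have he1 := (commute_onQubitHom hij.symm Pauli.X.matrix !![0, 0; 0, 1]).eq
  rw [SemiconjBy, cnotUnit_val]
  generalize onQubitHom i Pauli.X.matrix = x at *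
  generalize onQubitHom j Pauli.X.matrix = y at *
  generalize onQubitHom i !![1, 0; 0, 0] = e₀ at *
  generalize onQubitHom i !![0, 0; 0, 1] = e₁ at *
  rw [add_mul, mul_assoc, hx, ← mul_assoc, h1, h0, mul_assoc x y, mul_add, he0, ← mul_assoc y,
    he1, mul_assoc e₁, hX, mul_one, mul_add, mul_assoc, add_comm]

theorem cnotUnit_mem {i j : Fin n} (hij : i ≠ j) : cnotUnit hij ∈ cliffordGroup n := by
  refine mem_cliffordGroup_of_pow_four ?_ ?_ ?_ ?_
  · have h : cnotUnit hij * cnotUnit hij = 1 := Units.ext (cnotUnit hij).val_inv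
    rw [show 4 = 2 * 2 from rfl, pow_mul, sq (cnotUnit hij), h, one_pow]
  · exact Gate.matrix_mem_cliffordOperators (g := .cnot i j hij) id
  · intro k
    by_cases hi : i = k
    · subst hi
      exact ⟨_, mul_mem (onQubitHom_mem_scaledPaulis _ _) (onQubitHom_mem_scaledPaulis _ _),
        cnotUnit_semiconjBy_X hij⟩
    by_cases hj : j = k
    · subst hj
      exact ⟨_, onQubitHom_mem_scaledPaulis _ _, cnotUnit_commute_target hij⟩
    exact ⟨_, onQubitHom_mem_scaledPaulis _ _, cnotUnit_commute hij hi hj _⟩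
  · intro k
    by_cases hi : i = k
    · subst hi
      exact ⟨_, onQubitHom_mem_scaledPaulis _ _, cnotUnit_commute_control hij⟩
    by_cases hj : j = k
    · subst hj
      exact ⟨_, mul_mem (onQubitHom_mem_scaledPaulis _ _) (onQubitHom_mem_scaledPaulis _ _),
        cnotUnit_semiconjBy_Z hij⟩
    exact ⟨_, onQubitHom_mem_scaledPaulis _ _, cnotUnit_commute hij hi hj _⟩

/-! Simultaneous diagonalization. -/

/-- The Pauli `Z` operator on qubit `i`. -/
abbrev pauliZ (i : Fin n) : Operator n := onQubitHom i Pauli.Z.matrix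

/-- The witness is `H S² H = H Z H = X` on qubit `k`, which anticommutes with `Z` there. -/
theorem exists_clifford_neg_pauliZ (k : Fin n) : ∃ u ∈ cliffordGroup n,
    SemiconjBy ↑u (-pauliZ k) (pauliZ k) ∧ ∀ i, i ≠ k → Commute ↑u (pauliZ i) := by
  have hX : SemiconjBy ((phaseUnit k : Operator n) * phaseUnit k) (-onQubitHom k Pauli.X.matrix)
      (onQubitHom k Pauli.X.matrix) := by
    rw [← Units.val_mul, phaseUnit_mul_self, SemiconjBy, mul_neg, ← map_mul, ← map_mul, ← map_neg]
    simp [Pauli.matrix]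
  refine ⟨hadamardUnit k * (phaseUnit k * phaseUnit k) * hadamardUnit k,
    mul_mem (mul_mem (hadamardUnit_mem k) (mul_mem (phaseUnit_mem k) (phaseUnit_mem k)))
      (hadamardUnit_mem k), ?_, fun i hi => ?_⟩
  · rw [Units.val_mul, Units.val_mul, Units.val_mul]
    exact ((hadamardUnit_semiconjBy_X k).mul_left hX).mul_left
      (hadamardUnit_semiconjBy_Z k).neg_right
  · have hH := hadamardUnit_commute hi.symm Pauli.Z.matrix
    have hS := phaseUnit_commute hi.symm Pauli.Z.matrix
    simp only [Units.val_mul]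
    exact (hH.mul_left (hS.mul_left hS)).mul_left hH

/-- A non-trivial tensor factor of a Pauli operator can be made a `Z`. -/
theorem exists_clifford_update_Z (σ : Fin n → Pauli) {k : Fin n} (hk : σ k ≠ .I) :
    ∃ u ∈ cliffordGroup n, SemiconjBy ↑u (pauliTensor σ) (pauliTensor (update σ k .Z)) ∧
      ∀ i, i ≠ k → Commute ↑u (pauliZ i) := by
  have hcomp : (update (fun i => (σ i).matrix) k 1) k = 1 := by simp
  have hH : Commute ↑(hadamardUnit k) (pauliTensor (update σ k .I)) := by
    rw [pauliTensor_update]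
    exact hadamardUnit_commute_tensor hcomp
  have hS : Commute ↑(phaseUnit k) (pauliTensor (update σ k .I)) := by
    rw [pauliTensor_update]
    exact phaseUnit_commute_tensor hcomp
  rw [pauliTensor_eq_onQubitHom_mul k σ, pauliTensor_eq_onQubitHom_mul k (update σ k .Z),
    update_self, update_idem]
  cases h : σ k with
  | I => exact absurd h hk
  | X =>
    exact ⟨hadamardUnit k, hadamardUnit_mem k, (hadamardUnit_semiconjBy_X k).mul_right hH,
      fun i hi => hadamardUnit_commute hi.symm _⟩
  | Y =>
    -- The phase gate takes `X` to `Y`, so its inverse takes `Y` to `X`, and `H` takes `X` to `Z`.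
    refine ⟨hadamardUnit k * (phaseUnit k)⁻¹,
      mul_mem (hadamardUnit_mem k) (inv_mem (phaseUnit_mem k)), ?_, fun i hi => ?_⟩
    · rw [Units.val_mul]
      exact ((hadamardUnit_semiconjBy_X k).mul_left
        (phaseUnit_semiconjBy_X k).units_inv_symm_left).mul_right
        (SemiconjBy.mul_left hH (SemiconjBy.units_inv_symm_left hS))
    · rw [Units.val_mul]
      exact Commute.mul_left (hadamardUnit_commute hi.symm _)
        (SemiconjBy.units_inv_symm_left (phaseUnit_commute hi.symm _))
  | Z => exact ⟨1, one_mem _, SemiconjBy.one_left _, fun i _ => Commute.one_left _⟩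

/-- A controlled-not gate cancels a tensor factor `Z` against another one. -/
theorem cnotUnit_semiconjBy_pauliTensor (σ : Fin n → Pauli) {i j : Fin n} (hij : i ≠ j)
    (hi : σ i = .Z) (hj : σ j = .Z) :
    SemiconjBy ↑(cnotUnit hij) (pauliTensor σ) (pauliTensor (update σ i .I)) := by
  have hτ : Commute ↑(cnotUnit hij) (pauliTensor (update (update σ i .I) j .I)) := by
    rw [pauliTensor_update]
    refine cnotUnit_commute_tensor hij ?_ (by simp; rfl)
    simp [hij]
    rfl
  have hZ : pauliZ i * pauliZ i = 1 := by
    rw [← map_mul, Pauli.matrix_mul_self, map_one]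
  rw [pauliTensor_eq_onQubitHom_mul i σ, pauliTensor_eq_onQubitHom_mul j (update σ i .I),
    update_of_ne hij.symm, hi, hj, ← mul_assoc]
  -- The CNOT sends `Z_i Z_j` to `Z_i (Z_i Z_j) = Z_j`.
  have h := (SemiconjBy.mul_right (cnotUnit_commute_control hij)
    (cnotUnit_semiconjBy_Z hij)).mul_right hτ
  rwa [← mul_assoc (pauliZ i), hZ, one_mul] at h

/-- A Pauli operator with a tensor factor `Z` on qubit `k` can be mapped to `Z` on that qubit,
without changing the `Z` operators on a set `F` of other qubits, provided that it commutes
with them. -/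
theorem exists_clifford_pauliZ_of_eq_Z {F : Set (Fin n)} {k : Fin n} (hkF : k ∉ F)
    (W : Finset (Fin n)) : ∀ (σ : Fin n → Pauli), σ k = .Z →
      (∀ i ∈ F, σ i = .I ∨ σ i = .Z) → (∀ i, i ∉ W → i ≠ k → σ i = .I) →
      ∃ u ∈ cliffordGroup n, SemiconjBy ↑u (pauliTensor σ) (pauliZ k) ∧
        ∀ i ∈ F, Commute ↑u (pauliZ i) := by
  induction W using Finset.induction_on with
  | empty =>
    intro σ hk _ hW
    refine ⟨1, one_mem _, ?_, fun i _ => Commute.one_left _⟩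
    have hσ : σ = update (fun _ => .I) k .Z := by
      ext1 i
      by_cases h : i = k
      · subst h; simpa
      · simpa [h] using hW i (Finset.notMem_empty i) h
    have : pauliTensor σ = pauliZ k := by
      rw [hσ, pauliTensor_update]
      rfl
    rw [this]
    exact SemiconjBy.one_left _
  | insert a W _ ih =>
    intro σ hk hF hW
    by_cases hak : a = k
    · refine ih σ hk hF fun i hi hik => hW i ?_ hik
      rw [Finset.mem_insert]
      rintro (h | h)
      · exact hik (h.trans hak)
      · exact hi h
    by_cases ha : σ a = .I
    · refine ih σ hk hF fun i hi hik => ?_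
      by_cases h : i = a
      · rwa [h]
      · exact hW i (by simp [h, hi]) hik
    obtain ⟨u, hu, huσ, huF⟩ : ∃ u ∈ cliffordGroup n,
        SemiconjBy ↑u (pauliTensor σ) (pauliTensor (update σ a .Z)) ∧
        ∀ i ∈ F, Commute ↑u (pauliZ i) := by
      -- For `a ∈ F` the factor is already `Z`. Otherwise rotating qubit `a` cannot disturb the `Z`
      -- operators on `F`.
      by_cases haF : a ∈ F
      · refine ⟨1, one_mem _, ?_, fun i _ => Commute.one_left _⟩
        rw [← (hF a haF).resolve_left ha, update_eq_self]
        exact SemiconjBy.one_left _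
      · obtain ⟨u, hu, huσ, huF⟩ := exists_clifford_update_Z σ ha
        exact ⟨u, hu, huσ, fun i hi => huF i fun h => haF (h ▸ hi)⟩
    -- The CNOT has control `a` and target `k`: it commutes with `Z` on the control, which may lie
    -- in `F`, while the target does not.
    have hcnot := cnotUnit_semiconjBy_pauliTensor (update σ a .Z) hak (by simp)
      (by simpa [Ne.symm hak] using hk)
    rw [update_idem] at hcnot
    obtain ⟨v, hv, hvσ, hvF⟩ := ih (update σ a .I) (by simpa [Ne.symm hak] using hk)
      (fun i hi => by
        by_cases h : i = a
        · subst h; simp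
        · simpa [h] using hF i hi)
      (fun i hi hik => by
        by_cases h : i = a
        · subst h; simp
        · simpa [h] using hW i (by simp [h, hi]) hik)
    refine ⟨v * (cnotUnit hak * u), mul_mem hv (mul_mem (cnotUnit_mem hak) hu), ?_, ?_⟩
    · rw [Units.val_mul, Units.val_mul]
      exact hvσ.mul_left (hcnot.mul_left huσ)
    · intro i hi
      rw [Units.val_mul, Units.val_mul]
      refine (hvF i hi).mul_left (Commute.mul_left ?_ (huF i hi))
      by_cases h : i = a
      · subst h
        exact cnotUnit_commute_control hak
      · exact cnotUnit_commute hak (Ne.symm h) (fun h => hkF (h ▸ hi)) _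

theorem exists_clifford_pauliZ {F : Set (Fin n)} {σ : Fin n → Pauli} {k : Fin n} (hkF : k ∉ F)
    (hk : σ k ≠ .I) (hF : ∀ i ∈ F, σ i = .I ∨ σ i = .Z) :
    ∃ u ∈ cliffordGroup n, SemiconjBy ↑u (pauliTensor σ) (pauliZ k) ∧
      ∀ i ∈ F, Commute ↑u (pauliZ i) := by
  obtain ⟨u, hu, huσ, huF⟩ := exists_clifford_update_Z σ hk
  obtain ⟨v, hv, hvσ, hvF⟩ := exists_clifford_pauliZ_of_eq_Z hkF Finset.univ (update σ k .Z)
    (by simp) (fun i hi => by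
      have h : i ≠ k := fun h => hkF (h ▸ hi)
      simpa [h] using hF i hi) (by simp)
  refine ⟨v * u, mul_mem hv hu, ?_, fun i hi => ?_⟩
  · rw [Units.val_mul]
    exact hvσ.mul_left huσ
  · rw [Units.val_mul]
    exact (hvF i hi).mul_left (huF i fun h => hkF (h ▸ hi))

/-- `X` and `Y` anticommute with `Z`. Commuting and anticommuting at once would make the product of
two involutions zero. -/
theorem eq_I_or_eq_Z_of_commute {σ : Fin n → Pauli} {i : Fin n}
    (h : Commute (pauliTensor σ) (pauliZ i)) : σ i = .I ∨ σ i = .Z := by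
  have hτ : Commute (pauliZ i) (pauliTensor (update σ i .I)) := by
    rw [pauliTensor_update]
    exact commute_onQubitHom_tensor _ i (by simp; rfl)
  have key : ¬ (σ i).matrix * Pauli.Z.matrix = -(Pauli.Z.matrix * (σ i).matrix) := by
    intro hanti
    have hanti' : pauliTensor σ * pauliZ i = -(pauliZ i * pauliTensor σ) := by
      rw [pauliTensor_eq_onQubitHom_mul i σ, mul_assoc, ← hτ.eq, ← mul_assoc, ← map_mul, hanti,
        map_neg, map_mul, neg_mul, mul_assoc]
    have h0 : pauliZ i * pauliTensor σ = 0 := by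
      have h' := h.eq.symm.trans hanti'
      rwa [eq_neg_iff_add_eq_zero, ← two_smul ℂ, smul_eq_zero_iff_right two_ne_zero] at h'
    have h1 : pauliZ i * pauliZ i = 1 := by
      rw [← map_mul, Pauli.matrix_mul_self, map_one]
    have h2 : pauliTensor σ = 0 := by
      rw [← one_mul (pauliTensor σ), ← h1, mul_assoc, h0, mul_zero]
    have h3 := pauliTensor_mul_self σ
    rw [h2, mul_zero] at h3
    exact zero_ne_one h3
  cases hσ : σ i with
  | I => exact Or.inl rfl
  | Z => exact Or.inr rfl
  | X => rw [hσ] at key; exact absurd (by simp [Pauli.matrix]) key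
  | Y => rw [hσ] at key; exact absurd (by simp [Pauli.matrix]) key

open Classical in
/-- The label of the product of the `Z` operators on a set of qubits. -/
def zLabel (F : Set (Fin n)) (i : Fin n) : Pauli := if i ∈ F then .Z else .I

theorem pauliZ_mul_zLabel {F : Set (Fin n)} {k : Fin n} (hk : k ∉ F) :
    pauliZ k * pauliTensor (zLabel F) = pauliTensor (zLabel (insert k F)) := by
  rw [pauliTensor_eq_onQubitHom_mul k (zLabel (insert k F))]
  congr 2
  · simp [zLabel]
  · ext1 i
    by_cases h : i = k
    · subst h; simp [zLabel, hk]
    · by_cases hi : i ∈ F <;> simp [zLabel, h, hi]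

/-- Injectivity of `f` prevents any two `Z` factors from cancelling. This translates independence
into a condition on labels. -/
theorem semiconjBy_noncommProd {ι : Type*} [DecidableEq ι] {P : ι → Operator n}
    {f : ι → Fin n} {u : Operator n} (S : Finset ι)
    (hcomm : (S : Set ι).Pairwise (Commute on P)) (hf : Set.InjOn f S)
    (hu : ∀ j ∈ S, SemiconjBy u (P j) (pauliZ (f j))) :
    SemiconjBy u (S.noncommProd P hcomm) (pauliTensor (zLabel (f '' S))) := by
  induction S using Finset.induction_on with
  | empty =>
    have : pauliTensor (zLabel (f '' ((∅ : Finset ι) : Set ι))) = 1 := by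
      rw [← tensor_one, pauliTensor]
      congr 1
      ext1 i
      simp [zLabel]
      rfl
    rw [this]
    exact SemiconjBy.one_right u
  | insert a S ha ih =>
    have himage : f '' (insert a S : Finset ι) = insert (f a) (f '' S) := by
      rw [Finset.coe_insert, Set.image_insert_eq]
    rw [himage, Finset.noncommProd_insert_of_notMem _ _ _ _ ha, ← pauliZ_mul_zLabel]
    · refine (hu a (Finset.mem_insert_self a S)).mul_right (ih _ (hf.mono (by simp)) ?_)
      exact fun j hj => hu j (Finset.mem_insert_of_mem hj)
    · rintro ⟨j, hj, hja⟩
      have := hf (by simpa using Or.inr hj) (by simp) hja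
      exact ha (this ▸ hj)

theorem commute_of_semiconjBy {M : Type*} [Monoid M] {u : Mˣ} {x y x' y' : M}
    (hx : SemiconjBy ↑u x x') (hy : SemiconjBy ↑u y y') (h : Commute x y) : Commute x' y' := by
  have h1 := (hx.mul_right hy).eq
  rw [h.eq, (hy.mul_right hx).eq] at h1
  exact (u.isUnit.mul_left_inj.1 h1).symm

/-- Signed Pauli operators are conjugated to signed Pauli operators by the Clifford group. -/
theorem IsSignedPauli.exists_semiconjBy {P : Operator n} (hP : IsSignedPauli P)
    {u : (Operator n)ˣ} (hu : u ∈ cliffordGroup n) :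
    ∃ σ, SemiconjBy ↑u P (pauliTensor σ) ∨ SemiconjBy ↑u P (-pauliTensor σ) := by
  obtain ⟨c, σ, hc⟩ := hu.1.2 P hP.mem_scaledPaulis
  have hs : SemiconjBy ↑u P (c • pauliTensor σ) := (Units.mul_inv_eq_iff_eq_mul u).1 hc
  -- Squaring determines the scalar: `P² = 1` forces `c² = 1`.
  have h1 := (hs.mul_right hs).eq
  rw [hP.mul_self, mul_one, smul_mul_smul_comm, pauliTensor_mul_self, smul_mul_assoc, one_mul]
    at h1
  have h2 : (1 : Operator n) = (c * c) • 1 := by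
    have := congrArg (· * (↑u⁻¹ : Operator n)) h1
    simpa [smul_mul_assoc] using this
  have h3 : 1 = c * c := by
    have := congrFun (congrFun h2 0) 0
    simpa using this
  rcases mul_self_eq_one_iff.1 h3.symm with rfl | rfl
  · exact ⟨σ, Or.inl (by simpa using hs)⟩
  · exact ⟨σ, Or.inr (by simpa using hs)⟩

/-- On zero qubits the empty tensor product is 1, leaving only `±1`. -/
theorem IsSignedPauli.nonempty_qubits {P : Operator n} (hP : IsSignedPauli P) (h : P ≠ 1)
    (h' : P ≠ -1) : Nonempty (Fin n) := by
  by_contra hn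
  rw [not_nonempty_iff] at hn
  have hone : ∀ σ : Fin n → Pauli, tensor (fun i => (σ i).matrix) = 1 := fun σ => by
    rw [← tensor_one]
    congr 1
    exact Subsingleton.elim _ _
  obtain ⟨σ, rfl | rfl⟩ := hP
  · exact h (hone σ)
  · exact h' (by rw [hone σ])

/-- Independent commuting Pauli operators are conjugate to `Z` operators on distinct qubits under
the Clifford group. -/
theorem exists_clifford_semiconjBy_pauliZ {ι : Type*} [DecidableEq ι] {P : ι → Operator n}
    (hP : ∀ j, IsSignedPauli (P j)) (hcomm : ∀ i j, Commute (P i) (P j))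
    (hindep : ∀ S : Finset ι, S.Nonempty → ∀ hS : (S : Set ι).Pairwise (Commute on P),
      S.noncommProd P hS ≠ 1 ∧ S.noncommProd P hS ≠ -1) (s : Finset ι) :
    ∃ u ∈ cliffordGroup n, ∃ f : ι → Fin n, Set.InjOn f s ∧
      ∀ j ∈ s, SemiconjBy ↑u (P j) (pauliZ (f j)) := by
  induction s using Finset.induction_on with
  | empty =>
    -- `f` is a total function, so it needs values even for the empty set. Independence of a
    -- singleton supplies a qubit.
    have hn : ι → Nonempty (Fin n) := fun j => by
      have h := hindep {j} (Finset.singleton_nonempty j) (by simp)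
      rw [Finset.noncommProd_singleton] at h
      exact (hP j).nonempty_qubits h.1 h.2
    exact ⟨1, one_mem _, fun j => Classical.choice (hn j), by simp, by simp⟩
  | insert a s ha ih =>
    obtain ⟨u, hu, f, hf, huf⟩ := ih
    obtain ⟨σ, hσ⟩ := (hP a).exists_semiconjBy hu
    have hF : ∀ i ∈ f '' (s : Set ι), σ i = .I ∨ σ i = .Z := by
      rintro _ ⟨j, hj, rfl⟩
      apply eq_I_or_eq_Z_of_commute
      rcases hσ with h | h
      · exact commute_of_semiconjBy h (huf j hj) (hcomm a j)
      · exact (Commute.neg_left_iff).1 (commute_of_semiconjBy h (huf j hj) (hcomm a j))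
    -- Otherwise `pauliTensor σ` is the product of the `Z` operators on `f '' S`, that is, the
    -- conjugate of the product of `P` over `S`. As `pauliTensor σ` squares to 1, the product over
    -- `insert a S` would be `±1`.
    obtain ⟨k, hkF, hk⟩ : ∃ k, k ∉ f '' (s : Set ι) ∧ σ k ≠ .I := by
      by_contra! hall
      classical
      let S := s.filter fun j => σ (f j) = .Z
      have hSs : S ⊆ s := Finset.filter_subset _ _
      have hσS : σ = zLabel (f '' S) := by
        ext1 i
        by_cases hi : i ∈ f '' (S : Set ι)
        · rw [zLabel, if_pos hi]
          obtain ⟨j, hj, rfl⟩ := hi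
          exact (Finset.mem_filter.1 hj).2
        · rw [zLabel, if_neg hi]
          by_cases his : i ∈ f '' (s : Set ι)
          · refine (hF i his).resolve_right fun hZ => hi ?_
            obtain ⟨j, hj, rfl⟩ := his
            exact ⟨j, Finset.mem_filter.2 ⟨hj, hZ⟩, rfl⟩
          · exact hall i his
      have hprod := semiconjBy_noncommProd S (fun i _ j _ _ => hcomm i j)
        (hf.mono (Finset.coe_subset.2 hSs)) fun j hj => huf j (hSs hj)
      rw [← hσS] at hprod
      have hpair : ((insert a S : Finset ι) : Set ι).Pairwise (Commute on P) :=
        fun i _ j _ _ => hcomm i j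
      have hne := hindep (insert a S) (Finset.insert_nonempty a S) hpair
      rw [Finset.noncommProd_insert_of_notMem _ _ _ _ fun h => ha (hSs h)] at hne
      rcases hσ with h | h
      · have h1 := (h.mul_right hprod).eq
        rw [pauliTensor_mul_self, one_mul] at h1
        exact hne.1 (u.isUnit.mul_left_cancel (h1.trans (mul_one _).symm))
      · have h1 := (h.mul_right hprod).eq
        rw [neg_mul, pauliTensor_mul_self, neg_one_mul] at h1
        exact hne.2 (u.isUnit.mul_left_cancel (h1.trans (by simp)))
    obtain ⟨v, hv, hvσ, hvF⟩ := exists_clifford_pauliZ hkF hk hF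
    obtain ⟨w, hw, hwP, hwF⟩ : ∃ w ∈ cliffordGroup n, SemiconjBy ↑w (P a) (pauliZ k) ∧
        ∀ j ∈ s, SemiconjBy ↑w (P j) (pauliZ (f j)) := by
      have hvu : ∀ j ∈ s, SemiconjBy (v * u : Operator n) (P j) (pauliZ (f j)) := fun j hj =>
        SemiconjBy.mul_left (hvF _ ⟨j, hj, rfl⟩) (huf j hj)
      rcases hσ with h | h
      · refine ⟨v * u, mul_mem hv hu, ?_⟩
        rw [Units.val_mul]
        exact ⟨hvσ.mul_left h, hvu⟩
      -- The sign is flipped on qubit `k` alone, so the earlier `Z` operators survive.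
      · obtain ⟨x, hx, hxk, hxF⟩ := exists_clifford_neg_pauliZ k
        refine ⟨x * (v * u), mul_mem hx (mul_mem hv hu), ?_⟩
        rw [Units.val_mul, Units.val_mul]
        refine ⟨hxk.mul_left (hvσ.neg_right.mul_left h), fun j hj => ?_⟩
        exact SemiconjBy.mul_left (hxF _ fun h => hkF ⟨j, hj, h⟩) (hvu j hj)
    have hne : ∀ j ∈ s, j ≠ a := fun j hj h => ha (h ▸ hj)
    refine ⟨w, hw, update f a k, ?_, ?_⟩
    · have heq : Set.EqOn f (update f a k) s := fun j hj => (update_of_ne (hne j hj) _ _).symm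
      rw [Finset.coe_insert, Set.injOn_insert (by simpa using ha)]
      refine ⟨hf.congr heq, ?_⟩
      rwa [← heq.image_eq, update_self]
    · intro j hj
      rcases Finset.mem_insert.1 hj with rfl | hj
      · rwa [update_self]
      · rw [update_of_ne (hne j hj)]
        exact hwF j hj

/-! Circuits with parallel `T` gates. -/

/-- `R` has value 1 on the eigenvalue `1` and `omega` on the eigenvalue `-1`. -/
theorem Gate.t_matrix_eq_R (i : Fin n) : (Gate.t i).matrix = R (pauliZ i) := by
  rw [R, ← map_one (onQubitHom i), ← map_smul, ← map_smul, ← map_add]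
  change onQubitHom i _ = _
  congr 1
  ext a b
  fin_cases a <;> fin_cases b <;> simp [Pauli.matrix] <;> ring

theorem R_semiconjBy {u P Q : Operator n} (h : SemiconjBy u P Q) : SemiconjBy u (R P) (R Q) := by
  rw [SemiconjBy, R, R, mul_add, add_mul, mul_smul_comm, mul_smul_comm, smul_mul_assoc,
    smul_mul_assoc, h.eq, mul_one, one_mul]

theorem semiconjBy_list_prod {M ι : Type*} [Monoid M] {u : M} {x y : ι → M}
    (h : ∀ i, SemiconjBy u (x i) (y i)) (l : List ι) :
    SemiconjBy u (l.map x).prod (l.map y).prod := by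
  induction l with
  | nil => exact SemiconjBy.one_right u
  | cons i l ih =>
    rw [List.map_cons, List.map_cons, List.prod_cons, List.prod_cons]
    exact (h i).mul_right ih

/-- If the `T` gates of a circuit are consecutive and act on distinct qubits, then they can be
performed in parallel. -/
theorem Circuit.tDepth_le_one {a b : Circuit n} {l : List (Fin n)} (ha : ∀ g ∈ a, ¬ g.IsT)
    (hb : ∀ g ∈ b, ¬ g.IsT) (hl : l.Nodup) :
    Circuit.tDepth (a ++ l.map Gate.t ++ b) ≤ 1 := by
  set d : Circuit n := a ++ l.map Gate.t ++ b with hd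
  have hlen : d.length = a.length + l.length + b.length := by simp [hd, add_assoc]
  have hget : ∀ (i : ℕ) (hi : i < d.length) (h1 : a.length ≤ i) (h2 : i < a.length + l.length),
      d[i] = Gate.t (l[i - a.length]'(by omega)) := by
    intro i hi h1 h2
    simp only [hd]
    rw [List.getElem_append_left (by simpa using h2), List.getElem_append_right h1,
      List.getElem_map]
  -- All `T` gates share the time of the first one, and every other gate keeps its index. Order
  -- collapses only among `T` gates, whose supports are disjoint.
  let time : Fin d.length → ℕ := fun i =>
    if a.length ≤ i ∧ (i : ℕ) < a.length + l.length then a.length else i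
  have hsched : d.IsSchedule time := by
    intro i j hij hdis
    have hij' : (i : ℕ) < j := hij
    by_cases hi : a.length ≤ i ∧ (i : ℕ) < a.length + l.length
    · by_cases hj : a.length ≤ j ∧ (j : ℕ) < a.length + l.length
      · exfalso
        apply hdis
        rw [List.get_eq_getElem, List.get_eq_getElem, hget i i.2 hi.1 hi.2,
          hget j j.2 hj.1 hj.2]
        simp only [Gate.support, Finset.disjoint_singleton]
        intro h
        have := (hl.getElem_inj_iff).1 h
        omega
      · simp only [time, if_pos hi, if_neg hj]
        omega
    · by_cases hj : a.length ≤ j ∧ (j : ℕ) < a.length + l.length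
      · simp only [time, if_neg hi, if_pos hj]
        omega
      · simp only [time, if_neg hi, if_neg hj]
        exact hij'
  have hsub : time '' {i | (d.get i).IsT} ⊆ {a.length} := by
    rintro _ ⟨i, hi, rfl⟩
    have hi' : (d[(i : ℕ)]).IsT := hi
    rw [Set.mem_singleton_iff]
    refine if_pos ?_
    by_contra hdon
    rw [not_and_or, not_le, not_lt] at hdon
    rcases hdon with h | h
    · simp only [hd] at hi'
      rw [List.getElem_append_left (by simp; omega), List.getElem_append_left h] at hi'
      exact ha _ (List.getElem_mem _) hi'
    · simp only [hd] at hi'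
      rw [List.getElem_append_right (by simpa using h)] at hi'
      exact hb _ (List.getElem_mem _) hi'
  calc d.tDepth ≤ d.numTCycles time := Nat.sInf_le ⟨time, hsched, rfl⟩
    _ ≤ ({a.length} : Set ℕ).ncard := Set.ncard_le_ncard hsub
    _ = 1 := Set.ncard_singleton _

/-- A circuit with a `T` gate has positive `T`-depth. -/
theorem Circuit.tDepth_pos {c : Circuit n} {g : Gate n} (hg : g ∈ c) (hT : g.IsT) :
    0 < c.tDepth := by
  -- Nonemptiness matters: `sInf ∅ = 0` in `ℕ`. Since schedules exist, the infimum is attained.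
  obtain ⟨time, -, h⟩ := Nat.sInf_mem (s := {k | ∃ time : Fin c.length → ℕ,
    c.IsSchedule time ∧ c.numTCycles time = k})
    ((exists_isSchedule c).elim fun time h => ⟨_, time, h, rfl⟩)
  obtain ⟨i, rfl⟩ := List.mem_iff_get.1 hg
  rw [tDepth, ← h, numTCycles, Set.ncard_pos (Set.toFinite _)]
  exact ⟨_, i, hT, rfl⟩

end CliffordT

end

theorem theorem2 (n m : ℕ) (P : Fin m → CliffordT.Operator n)
    (hP : ∀ j, CliffordT.IsSignedPauli (P j))
    (hcomm : ∀ i j, Commute (P i) (P j))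
    (hindep : ¬ ∃ S : Finset (Fin m), S.Nonempty ∧
      (S.noncommProd P (fun i _ j _ _ => hcomm i j) = 1 ∨
        S.noncommProd P (fun i _ j _ _ => hcomm i j) = -1)) :
    ∃ c : CliffordT.Circuit n,
      c.eval = (List.ofFn fun j => CliffordT.R (P j)).prod ∧
      c.tDepth ≤ 1 ∧ (0 < m → c.tDepth = 1) := by
  obtain ⟨u, hu, f, hf, huf⟩ := CliffordT.exists_clifford_semiconjBy_pauliZ hP hcomm
    (fun S hS _ => ⟨fun h => hindep ⟨S, hS, Or.inl h⟩, fun h => hindep ⟨S, hS, Or.inr h⟩⟩)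
    Finset.univ
  obtain ⟨a, ha, hau⟩ := hu.1.1
  obtain ⟨b, hb, hbu⟩ := hu.2.1
  have hf' : Function.Injective f := fun i j h => hf (by simp) (by simp) h
  -- The circuit `a` implements `u` and `b` implements `u⁻¹`. The `T` list is reversed because later
  -- gates multiply on the left, so that the factors appear in the order of the product.
  have hle := CliffordT.Circuit.tDepth_le_one (l := ((List.finRange m).map f).reverse) ha hb
    (List.nodup_reverse.2 ((List.nodup_finRange m).map hf'))
  refine ⟨_, ?_, hle, fun hm => le_antisymm hle ?_⟩
  · rw [CliffordT.Circuit.eval_append, CliffordT.Circuit.eval_append, hau, hbu, List.map_reverse,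
      CliffordT.Circuit.eval_reverse, List.map_map, List.map_map, List.ofFn_eq_map]
    have h := CliffordT.semiconjBy_list_prod
      (fun j => CliffordT.R_semiconjBy (huf j (Finset.mem_univ j))) (List.finRange m)
    have hT : CliffordT.Gate.matrix ∘ CliffordT.Gate.t ∘ f =
        fun j => CliffordT.R (CliffordT.pauliZ (f j)) :=
      funext fun j => CliffordT.Gate.t_matrix_eq_R (f j)
    rw [Function.comp_assoc, hT, ← h.eq, Units.inv_mul_cancel_left]
  · refine CliffordT.Circuit.tDepth_pos (g := .t (f ⟨0, hm⟩)) ?_ trivial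
    simp
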